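/- Let $R$ be a countable ring or, more generally, a small preadditive category with countably many objects and morphisms; $\mathrm{Mod}\text{-}R$ denotes the category of right $R$-modules (in the general case: additive contravariant functors from $R$ to abelian groups, whose elements then have sorts, the objects of $R$). Tuples are finite. A *pp formula* $\phi(\bar x)$ has the form $\exists \bar y\,\bigwedge_{j=1}^m \sum_i x_i r_{ij}+\sum_k y_k s_{kj}=0$ with coefficients in $R$; it is *quantifier-free* if there are no $y_k$. Its solution set in $M$ is $\phi(M)$, and the *pp-type* of a tuple $\bar a$ from $M$ is $\mathrm{pp}^M(\bar a)=\{\phi : \bar a\in\phi(M)\}$. A class $\mathcal D$ of $R$-modules is a *definable subcategory* if, for some set $\Phi$ of pairs $(\phi,\psi)$ of pp formulas in the same free variables with $\psi(M)\subseteq\phi(M)$ for all modules $M$, it consists of the modules $M$ with $\phi(M)=\psi(M)$ for all $(\phi,\psi)\in\Phi$. For a pp formula $\phi$ put $\langle\phi\rangle_{\mathcal D}=\{\psi \text{ pp}: \phi(D)\subseteq\psi(D)\text{ for all }D\in\mathcal D\}$, and $\langle\phi\rangle=\langle\phi\rangle_{\mathrm{Mod}\text{-}R}$. A *free realisation* of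 $\phi$ is a finitely presented module $B$ with a tuple $\bar b$ such that $\mathrm{pp}^B(\bar b)=\langle\phi\rangle$. A module $M\in\mathcal D$ is *strictly $\mathcal D$-atomic* if for every tuple $\bar a$ from $M$ there is a pp formula $\phi$ with $\mathrm{pp}^M(\bar a)=\langle\phi\rangle_{\mathcal D}$ and, for every such $\phi$, every $D\in\mathcal D$ and every $\bar b\in\phi(D)$, there is a morphism $f:M\to D$ with $f\bar a=\bar b$. A *$\mathcal D$-preenvelope* of $A$ is a morphism $f:A\to D_A$ with $D_A\in\mathcal D$ through which every morphism from $A$ to a module in $\mathcal D$ factors. **Theorem.** Let $\mathcal D$ be a definable subcategory of $\mathrm{Mod}\text{-}R$ and let $A$ be a finitely presented $R$-module. Then there is a $\mathcal D$-preenvelope $f:A\to D_A$ such that 1. $D_A$ is strictly $\mathcal D$-atomic; 2. for every tuple $\bar a$ generating $A$ there is a quantifier-free pp formula $\theta$ with $\mathrm{pp}^A(\bar a)=\langle\theta\rangle$ and $\mathrm{pp}^{D_A}(f\bar a)=\langle\theta\rangle_{\mathcal D}$; 3. $D_A$ is the direct limit of a chain of free realisations starting at $A$: there are finitely presented modules and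 morphisms $B_0\xrightarrow{f_0}B_1\xrightarrow{f_1}B_2\to\cdots$ with $B_0\cong A$ and $D_A=\varinjlim B_n$, where $f$ is the resulting map $A\cong B_0\to D_A$, such that for each $n$ there are a generating tuple $\bar b_n$ of $B_n$, a quantifier-free pp formula $\theta_n$ with $\mathrm{pp}^{B_n}(\bar b_n)=\langle\theta_n\rangle$, and a pp formula $\sigma_n$ with $\sigma_n(M)\subseteq\theta_n(M)$ for all modules $M$ and $\sigma_n(D)=\theta_n(D)$ for all $D\in\mathcal D$, for which $(B_{n+1},f_n\bar b_n)$ is a free realisation of $\sigma_n$. -/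

import Mathlib

open CategoryTheory Opposite

universe v w

namespace PPModules

/-- The category of right `C`-modules over a preadditive category `C` (a "ring with many objects"):
additive contravariant functors from `C` to abelian groups.  An ordinary ring `R` is the case
`C = SingleObj R`; a module is then one abelian group `M` with `(m * s) * r = m * (s * r)`. -/
abbrev RMod (C : Type w) [Category.{v} C] [Preadditive C] : Type (max w (v + 1)) :=
  Cᵒᵖ ⥤+ AddCommGrpCat.{v}

section

variable {C : Type w} [Category.{v} C] [Preadditive C]

/-- The elements of sort `X` of a module. -/
abbrev Elt (M : RMod C) (X : C) : Type v := M.obj.obj (op X)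

/-- The right action `m ↦ m * r`, from the elements of sort `Y` to those of sort `X`. -/
def act (M : RMod C) {X Y : C} (m : Elt M Y) (r : X ⟶ Y) : Elt M X :=
  (M.obj.map r.op).hom m

/-- Finite tuples of elements of a module, with prescribed sorts. -/
abbrev Tuple (M : RMod C) {n : ℕ} (X : Fin n → C) : Type v := (i : Fin n) → Elt M (X i)

/-- The image of a tuple under a morphism of modules. -/
def Tuple.map {M N : RMod C} (f : M ⟶ N) {n : ℕ} {X : Fin n → C} (a : Tuple M X) : Tuple N X :=
  fun i => (f.hom.app (op (X i))).hom (a i)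

/-- The linear combination `∑ i, a i * r i`. -/
def lin {M : RMod C} {n : ℕ} {X : Fin n → C} (a : Tuple M X) {W : C} (r : (i : Fin n) → (W ⟶ X i)) :
    Elt M W :=
  ∑ i, act M (a i) (r i)

/-- The tuple `a` generates the module `M`. -/
def Generates {M : RMod C} {n : ℕ} {X : Fin n → C} (a : Tuple M X) : Prop :=
  ∀ (W : C) (m : Elt M W), ∃ r : (i : Fin n) → (W ⟶ X i), lin a r = m

/-- A module is finitely presented if it has a finite generating tuple such that all linear
relations between its entries follow from finitely many of them. -/
def IsFP (M : RMod C) : Prop :=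
  ∃ (n : ℕ) (X : Fin n → C) (a : Tuple M X), Generates a ∧
    ∃ (m : ℕ) (Z : Fin m → C) (r : (j : Fin m) → (i : Fin n) → (Z j ⟶ X i)),
      (∀ j, lin a (r j) = 0) ∧
      ∀ (W : C) (c : (i : Fin n) → (W ⟶ X i)), lin a c = 0 →
        ∃ d : (j : Fin m) → (W ⟶ Z j), ∀ i, c i = ∑ j, d j ≫ r j i

/-- A pp formula with free variables `x i` of sorts `X i`:
`∃ y, ⋀ j, ∑ i, x i * r j i + ∑ k, y k * s j k = 0`. -/
structure PPFormula {n : ℕ} (X : Fin n → C) where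
  /-- the number of existentially quantified variables -/
  numBound : ℕ
  /-- their sorts -/
  Y : Fin numBound → C
  /-- the number of equations -/
  numEqs : ℕ
  /-- their sorts -/
  Z : Fin numEqs → C
  /-- coefficients of the free variables -/
  r : (j : Fin numEqs) → (i : Fin n) → (Z j ⟶ X i)
  /-- coefficients of the quantified variables -/
  s : (j : Fin numEqs) → (k : Fin numBound) → (Z j ⟶ Y k)

/-- The formula has no quantifiers. -/
def PPFormula.IsQF {n : ℕ} {X : Fin n → C} (φ : PPFormula X) : Prop := φ.numBound = 0

/-- The solution set `φ(M)`. -/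
def PPFormula.sol {n : ℕ} {X : Fin n → C} (φ : PPFormula X) (M : RMod C) : Set (Tuple M X) :=
  {a | ∃ b : Tuple M φ.Y, ∀ j, lin a (φ.r j) + lin b (φ.s j) = 0}

/-- `φ ≤_D ψ`: every solution of `φ` in a module from `D` is a solution of `ψ`.
For `D = ⊤` this is the ordering of pp formulas over all modules. -/
def LEOn (D : ObjectProperty (RMod C)) {n : ℕ} {X : Fin n → C} (φ ψ : PPFormula X) : Prop :=
  ∀ M : RMod C, D M → φ.sol M ⊆ ψ.sol M

/-- A pp-pair `φ / ψ`: two pp formulas in the same free variables with `ψ ≤ φ`. -/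
structure PPPair (C : Type w) [Category.{v} C] [Preadditive C] where
  {n : ℕ}
  {X : Fin n → C}
  φ : PPFormula X
  ψ : PPFormula X
  le : LEOn ⊤ ψ φ

/-- The pair `φ / ψ` is closed on `M`. -/
def PPPair.ClosedOn (p : PPPair C) (M : RMod C) : Prop := p.φ.sol M = p.ψ.sol M

/-- `D` is (the class of objects of) a definable subcategory: membership is closure of each of some
set of pp-pairs. -/
def IsDefinable (D : ObjectProperty (RMod C)) : Prop :=
  ∃ Φ : Set (PPPair C), ∀ M : RMod C, D M ↔ ∀ p ∈ Φ, p.ClosedOn M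

/-- The pp-type of a tuple in a module. -/
def ppType {M : RMod C} {n : ℕ} {X : Fin n → C} (a : Tuple M X) : Set (PPFormula X) :=
  {φ | a ∈ φ.sol M}

/-- The pp-type `⟨φ⟩_D` generated by `φ` modulo `D`; `⟨φ⟩` is the case `D = ⊤`. -/
def gen (D : ObjectProperty (RMod C)) {n : ℕ} {X : Fin n → C} (φ : PPFormula X) :
    Set (PPFormula X) :=
  {ψ | LEOn D φ ψ}

/-- `M` is `D`-atomic: it is in `D` and every pp-type realised in it is `D`-finitely generated. -/
def IsAtomic (D : ObjectProperty (RMod C)) (M : RMod C) : Prop :=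
  D M ∧ ∀ (n : ℕ) (X : Fin n → C) (a : Tuple M X), ∃ φ : PPFormula X, ppType a = gen D φ

/-- `M` is strictly `D`-atomic. -/
def IsStrictlyAtomic (D : ObjectProperty (RMod C)) (M : RMod C) : Prop :=
  IsAtomic D M ∧
    ∀ (n : ℕ) (X : Fin n → C) (a : Tuple M X) (φ : PPFormula X), ppType a = gen D φ →
      ∀ N : RMod C, D N → ∀ b ∈ φ.sol N, ∃ f : M ⟶ N, a.map f = b

/-- `f : A ⟶ M` is a `D`-preenvelope of `A`. -/
def IsPreenvelope (D : ObjectProperty (RMod C)) {A M : RMod C} (f : A ⟶ M) : Prop :=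
  D M ∧ ∀ (N : RMod C) (g : A ⟶ N), D N → ∃ h : M ⟶ N, f ≫ h = g

/-- `(M, a)` is a free realisation of `φ`. -/
def IsFreeRealisation {n : ℕ} {X : Fin n → C} (φ : PPFormula X) (M : RMod C) (a : Tuple M X) :
    Prop :=
  IsFP M ∧ ppType a = gen ⊤ φ

/-- The set of pp formulas `ψ ≤ φ` such that the pp-pair `φ / ψ` is closed on `D`. -/
def down (D : ObjectProperty (RMod C)) {n : ℕ} {X : Fin n → C} (φ : PPFormula X) :
    Set (PPFormula X) :=
  {ψ | LEOn ⊤ ψ φ ∧ ∀ M : RMod C, D M → φ.sol M = ψ.sol M}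

/-- `B 0 ⟶ B 1 ⟶ B 2 ⟶ ⋯` is a chain of free realisations relative to `D`: each `B k` has a
generating tuple `b` which freely realises a quantifier-free formula `θ`, and the image of `b` in
`B (k + 1)` freely realises a pp formula `σ ≤ θ` which is equivalent to `θ` on `D`. -/
def IsFreeRealisationChain (D : ObjectProperty (RMod C)) (B : ℕ ⥤ RMod C) : Prop :=
  ∀ k : ℕ, ∃ (n : ℕ) (X : Fin n → C) (b : Tuple (B.obj k) X) (θ σ : PPFormula X),
    Generates b ∧ θ.IsQF ∧ IsFreeRealisation θ (B.obj k) b ∧ σ ∈ down D θ ∧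
      IsFreeRealisation σ (B.obj (k + 1)) (b.map (B.map (homOfLE (Nat.le_succ k))))

end

end PPModules

/-! The preenvelope comes from a Henkin-style construction. If a generating tuple `b` of `B` has all
its relations generated by a finite system `θ`, then maps `B ⟶ N` correspond to solutions of `θ` in
`N`. Let `ψ` be a pp formula implied by `θ` on `D`, and let `B'` freely realise `θ ∧ ψ`. Both
formulas have the same solutions in a module `N` of `D`, so every map `B ⟶ N` extends to `B'`.
Starting at `A`, iterate this. There are only countably many pp formulas, so a pairing function
ensures that each formula implied on `D` at some stage is eventually realised (`Stage.exists_step`,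
`Stage.mem_sol_colimit`).

In the colimit `L`, the image of a stage tuple `b` satisfies `ψ` exactly when `θ` implies `ψ` on
`D`: one direction is the bookkeeping; the other holds because maps to modules of `D` extend to `L`
and preserve pp formulas. Every tuple of `L` has the form `b r`, so its pp-type is generated modulo
`D` by `∃ x, θ(x) ∧ y = x r`. Closure of the defining pairs passes from `D` to `L` by the same
equivalence, and the extension property gives both the preenvelope and strictness. -/

namespace PPModules

section

variable {C : Type w} [Category.{v} C] [Preadditive C]

/-! ### The action and linear combinations -/

/-- The action of a fixed scalar, as an additive map. -/
def actHom (M : RMod C) {X Y : C} (r : X ⟶ Y) : Elt M Y →+ Elt M X :=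
  (M.obj.map r.op).hom

theorem act_add_right (M : RMod C) {X Y : C} (m : Elt M Y) (r s : X ⟶ Y) :
    act M m (r + s) = act M m r + act M m s := by
  simp [act, M.obj.map_add]

/-- The action on a fixed element, as an additive map. -/
def actHomRight (M : RMod C) {X Y : C} (m : Elt M Y) : (X ⟶ Y) →+ Elt M X :=
  AddMonoidHom.mk' (act M m) (act_add_right M m)

theorem act_zero_left (M : RMod C) {X Y : C} (r : X ⟶ Y) : act M (0 : Elt M Y) r = 0 :=
  (actHom M r).map_zero

theorem act_zero_right (M : RMod C) {X Y : C} (m : Elt M Y) : act M m (0 : X ⟶ Y) = 0 :=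
  (actHomRight M m).map_zero

theorem act_neg_right (M : RMod C) {X Y : C} (m : Elt M Y) (r : X ⟶ Y) :
    act M m (-r) = -act M m r :=
  (actHomRight M m).map_neg r

theorem act_id (M : RMod C) {X : C} (m : Elt M X) : act M m (𝟙 X) = m := by
  simp [act]

theorem act_act (M : RMod C) {X Y Z : C} (m : Elt M Z) (r : Y ⟶ Z) (s : X ⟶ Y) :
    act M (act M m r) s = act M m (s ≫ r) := by
  simp [act]

theorem act_sum_left (M : RMod C) {ι : Type*} (t : Finset ι) {X Y : C} (m : ι → Elt M Y)
    (r : X ⟶ Y) : act M (∑ i ∈ t, m i) r = ∑ i ∈ t, act M (m i) r :=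
  map_sum (actHom M r) m t

theorem act_sum_right (M : RMod C) {ι : Type*} (t : Finset ι) {X Y : C} (m : Elt M Y)
    (r : ι → (X ⟶ Y)) : act M m (∑ i ∈ t, r i) = ∑ i ∈ t, act M m (r i) :=
  map_sum (actHomRight M m) r t

/-- The map on elements of a fixed sort induced by a morphism of modules. -/
def mapElt {M N : RMod C} (f : M ⟶ N) (X : C) : Elt M X →+ Elt N X :=
  (f.hom.app (op X)).hom

theorem mapElt_act {M N : RMod C} (f : M ⟶ N) {X Y : C} (m : Elt M Y) (r : X ⟶ Y) :
    mapElt f X (act M m r) = act N (mapElt f Y m) r :=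
  ConcreteCategory.congr_hom (f.hom.naturality r.op) m

theorem mapElt_comp {M N P : RMod C} (f : M ⟶ N) (g : N ⟶ P) (X : C) (m : Elt M X) :
    mapElt (f ≫ g) X m = mapElt g X (mapElt f X m) := rfl

theorem hom_ext_elt {M N : RMod C} {f g : M ⟶ N} (h : ∀ X m, mapElt f X m = mapElt g X m) :
    f = g := by
  apply ObjectProperty.hom_ext
  ext X m
  exact h (unop X) m

/-- A natural family of additive maps is a morphism of modules. -/
def homMk {M N : RMod C} (F : ∀ X, Elt M X →+ Elt N X)
    (hF : ∀ {X Y : C} (m : Elt M Y) (r : X ⟶ Y), F X (act M m r) = act N (F Y m) r) : M ⟶ N :=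
  ObjectProperty.homMk
    { app := fun X => AddCommGrpCat.ofHom (F (unop X))
      naturality := fun X Y r => by
        ext m
        exact hF m r.unop }

/-- Linear combinations of a family of elements with an arbitrary finite index type. -/
def linComb {M : RMod C} {ι : Type*} [Fintype ι] {X : ι → C} (a : ∀ i, Elt M (X i)) {W : C}
    (r : ∀ i, W ⟶ X i) : Elt M W :=
  ∑ i, act M (a i) (r i)

section linComb

variable {M N : RMod C} {ι κ : Type*} [Fintype ι] [Fintype κ] {X : ι → C} {Y : κ → C} {V W : C}

theorem lin_eq_linComb {n : ℕ} {X : Fin n → C} (a : Tuple M X) (r : ∀ i, W ⟶ X i) :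
    lin a r = linComb a r := rfl

theorem linComb_add (a : ∀ i, Elt M (X i)) (r s : ∀ i, W ⟶ X i) :
    linComb a (fun i => r i + s i) = linComb a r + linComb a s := by
  simp [linComb, act_add_right, Finset.sum_add_distrib]

theorem linComb_zero (a : ∀ i, Elt M (X i)) : linComb a (fun i => (0 : W ⟶ X i)) = 0 := by
  simp [linComb, act_zero_right]

theorem linComb_neg (a : ∀ i, Elt M (X i)) (r : ∀ i, W ⟶ X i) :
    linComb a (fun i => - r i) = - linComb a r := by
  simp [linComb, act_neg_right]

theorem linComb_sub (a : ∀ i, Elt M (X i)) (r s : ∀ i, W ⟶ X i) :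
    linComb a (fun i => r i - s i) = linComb a r - linComb a s := by
  simp only [sub_eq_add_neg, linComb_add, linComb_neg]

theorem linComb_single [DecidableEq ι] (a : ∀ i, Elt M (X i)) (i : ι) (r : W ⟶ X i) :
    linComb a (Pi.single i r) = act M (a i) r := by
  rw [linComb, Finset.sum_eq_single i]
  · simp
  · intro j _ hj
    rw [Pi.single_eq_of_ne hj, act_zero_right]
  · simp

theorem act_linComb (a : ∀ i, Elt M (X i)) (r : ∀ i, W ⟶ X i) (s : V ⟶ W) :
    act M (linComb a r) s = linComb a (fun i => s ≫ r i) := by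
  simp [linComb, act_sum_left, act_act]

theorem linComb_linComb (a : ∀ i, Elt M (X i)) (r : ∀ k i, Y k ⟶ X i) (s : ∀ k, W ⟶ Y k) :
    linComb (fun k => linComb a (r k)) s = linComb a (fun i => ∑ k, s k ≫ r k i) := by
  simp only [linComb, act_sum_left, act_act, act_sum_right]
  exact Finset.sum_comm

theorem linComb_zero_left (r : ∀ i, W ⟶ X i) : linComb (fun i => (0 : Elt M (X i))) r = 0 := by
  simp [linComb, act_zero_left]

theorem mapElt_linComb (f : M ⟶ N) (a : ∀ i, Elt M (X i)) (r : ∀ i, W ⟶ X i) :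
    mapElt f W (linComb a r) = linComb (fun i => mapElt f (X i) (a i)) r := by
  simp [linComb, mapElt_act]

theorem linComb_equiv (e : κ ≃ ι) (a : ∀ i, Elt M (X i)) (r : ∀ i, W ⟶ X i) :
    linComb (fun k => a (e k)) (fun k => r (e k)) = linComb a r :=
  e.sum_comp (fun i => act M (a i) (r i))

theorem linComb_sum_elim {X : ι ⊕ κ → C} (a : ∀ i, Elt M (X i)) (r : ∀ i, W ⟶ X i) :
    linComb a r =
      linComb (fun i => a (Sum.inl i)) (fun i => r (Sum.inl i)) +
        linComb (fun k => a (Sum.inr k)) (fun k => r (Sum.inr k)) :=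
  Fintype.sum_sum_type _

end linComb

/-- The entries of a tuple obtained from a tuple by a matrix of scalars. -/
def Tuple.mul {M : RMod C} {m n : ℕ} {X : Fin m → C} {Y : Fin n → C} (a : Tuple M X)
    (r : ∀ i j, Y i ⟶ X j) : Tuple M Y :=
  fun i => lin a (r i)

theorem Tuple.map_apply {M N : RMod C} (f : M ⟶ N) {n : ℕ} {X : Fin n → C} (a : Tuple M X)
    (i : Fin n) : a.map f i = mapElt f (X i) (a i) := rfl

theorem Tuple.map_comp {M N P : RMod C} (f : M ⟶ N) (g : N ⟶ P) {n : ℕ} {X : Fin n → C}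
    (a : Tuple M X) : a.map (f ≫ g) = (a.map f).map g := rfl

theorem mapElt_lin {M N : RMod C} (f : M ⟶ N) {n : ℕ} {X : Fin n → C} (a : Tuple M X) {W : C}
    (r : ∀ i, W ⟶ X i) : mapElt f W (lin a r) = lin (a.map f) r :=
  mapElt_linComb f a r

theorem Tuple.map_mul {M N : RMod C} (f : M ⟶ N) {m n : ℕ} {X : Fin m → C} {Y : Fin n → C}
    (a : Tuple M X) (r : ∀ i j, Y i ⟶ X j) : (a.mul r).map f = (a.map f).mul r :=
  funext fun i => mapElt_lin f a (r i)

theorem Generates.exists_mul {M : RMod C} {m n : ℕ} {X : Fin m → C} {Y : Fin n → C}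
    {a : Tuple M X} (ha : Generates a) (b : Tuple M Y) : ∃ r : ∀ i j, Y i ⟶ X j, a.mul r = b := by
  choose r hr using fun i => ha (Y i) (b i)
  exact ⟨r, funext hr⟩

/-- A generating tuple is sent to any tuple satisfying at least the same linear relations. -/
theorem Generates.exists_hom {M N : RMod C} {n : ℕ} {X : Fin n → C} {a : Tuple M X}
    (ha : Generates a) (c : Tuple N X)
    (h : ∀ (W : C) (r : ∀ i, W ⟶ X i), lin a r = 0 → lin c r = 0) : ∃ f : M ⟶ N, a.map f = c := by
  choose r hr using ha
  -- Two expressions of one element differ by a relation, so the choice of coefficients is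
  -- immaterial.
  have key : ∀ (W : C) (s : ∀ i, W ⟶ X i) (m : Elt M W), lin a s = m → lin c (r W m) = lin c s := by
    intro W s m hs
    rw [← sub_eq_zero]
    refine (linComb_sub c _ _).symm.trans (h W _ ?_)
    refine (linComb_sub a _ _).trans ?_
    rw [sub_eq_zero]
    exact (hr W m).trans hs.symm
  let F : ∀ W, Elt M W →+ Elt N W := fun W => AddMonoidHom.mk' (fun m => lin c (r W m)) <| by
    intro m m'
    rw [key W (fun i => r W m i + r W m' i)]
    · exact linComb_add c _ _
    · exact (linComb_add a _ _).trans (by rw [← lin_eq_linComb, ← lin_eq_linComb, hr, hr])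
  refine ⟨homMk F ?_, ?_⟩
  · intro V W m s
    refine (key V (fun i => s ≫ r W m i) _ ?_).trans (act_linComb c _ s).symm
    exact (act_linComb a _ s).symm.trans (by rw [← lin_eq_linComb, hr])
  · funext i
    classical
    refine (key (X i) (Pi.single i (𝟙 _)) (a i) ?_).trans ?_
    · exact (linComb_single a i _).trans (act_id M _)
    · exact (linComb_single c i _).trans (act_id N _)

theorem exists_comp_equiv_eq {ι κ : Type*} {β : ι → Type*} (e : κ ≃ ι) (b : ∀ k, β (e k)) :
    ∃ b' : ∀ i, β i, (fun k => b' (e k)) = b :=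
  ⟨Equiv.piCongrLeft β e b, funext (Equiv.piCongrLeft_apply_apply β e b)⟩

/-! ### Operations on pp formulas -/

section Formulas

variable {n : ℕ} {X : Fin n → C}

/-- Countability of the scalars enters the proof through this enumeration of formulas. -/
instance [Countable C] [∀ X Y : C, Countable (X ⟶ Y)] : Countable (PPFormula X) := by
  let F : PPFormula X → Σ (k : ℕ) (Y : Fin k → C) (m : ℕ) (Z : Fin m → C),
      ((j : Fin m) → (i : Fin n) → (Z j ⟶ X i)) × ((j : Fin m) → (i : Fin k) → (Z j ⟶ Y i)) :=
    fun φ => ⟨φ.numBound, φ.Y, φ.numEqs, φ.Z, φ.r, φ.s⟩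
  refine Function.Injective.countable (f := F) ?_
  rintro ⟨_, _, _, _, _, _⟩ ⟨_, _, _, _, _, _⟩ h
  cases h
  rfl

/-- A pp formula whose quantified variables and equations are indexed by arbitrary finite types. -/
noncomputable def PPFormula.ofFintype {κ μ : Type} [Fintype κ] [Fintype μ] {Y : κ → C} {Z : μ → C}
    (r : ∀ j i, Z j ⟶ X i) (s : ∀ j k, Z j ⟶ Y k) : PPFormula X where
  numBound := Fintype.card κ
  Y k := Y ((Fintype.equivFin κ).symm k)
  numEqs := Fintype.card μ
  Z j := Z ((Fintype.equivFin μ).symm j)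
  r j i := r ((Fintype.equivFin μ).symm j) i
  s j k := s ((Fintype.equivFin μ).symm j) ((Fintype.equivFin κ).symm k)

theorem PPFormula.mem_sol_ofFintype {κ μ : Type} [Fintype κ] [Fintype μ] {Y : κ → C} {Z : μ → C}
    {r : ∀ j i, Z j ⟶ X i} {s : ∀ j k, Z j ⟶ Y k} {M : RMod C} {a : Tuple M X} :
    a ∈ (PPFormula.ofFintype r s).sol M ↔
      ∃ b : ∀ k, Elt M (Y k), ∀ j, lin a (r j) + linComb b (s j) = 0 := by
  let e := (Fintype.equivFin κ).symm
  constructor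
  · rintro ⟨b, hb⟩
    obtain ⟨b, rfl⟩ := exists_comp_equiv_eq (β := fun k => Elt M (Y k)) e b
    refine ⟨b, fun j => ?_⟩
    obtain ⟨j, rfl⟩ := (Fintype.equivFin μ).symm.surjective j
    refine Eq.trans ?_ (hb j)
    exact congrArg _ (linComb_equiv e b _).symm
  · rintro ⟨b, hb⟩
    refine ⟨fun k => b (e k), fun j => Eq.trans ?_ (hb ((Fintype.equivFin μ).symm j))⟩
    exact congrArg _ (linComb_equiv e b _)

theorem PPFormula.sol_map (φ : PPFormula X) {M N : RMod C} (f : M ⟶ N) {a : Tuple M X}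
    (ha : a ∈ φ.sol M) : a.map f ∈ φ.sol N := by
  obtain ⟨b, hb⟩ := ha
  refine ⟨b.map f, fun j => ?_⟩
  rw [← mapElt_lin, ← mapElt_lin, ← map_add, hb, map_zero]

theorem PPFormula.IsQF.mem_sol {φ : PPFormula X} (h : φ.IsQF) {M : RMod C} {a : Tuple M X} :
    a ∈ φ.sol M ↔ ∀ j, lin a (φ.r j) = 0 := by
  have : IsEmpty (Fin φ.numBound) := by rw [h]; infer_instance
  have key : ∀ (b : Tuple M φ.Y) (j), lin a (φ.r j) + lin b (φ.s j) = lin a (φ.r j) := by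
    intro b j
    simp [lin]
  constructor
  · rintro ⟨b, hb⟩ j
    rw [← key b j, hb]
  · intro h
    exact ⟨isEmptyElim, fun j => (key _ j).trans (h j)⟩

/-- The conjunction of two pp formulas. -/
noncomputable def PPFormula.and (φ ψ : PPFormula X) : PPFormula X :=
  PPFormula.ofFintype (κ := Fin φ.numBound ⊕ Fin ψ.numBound) (μ := Fin φ.numEqs ⊕ Fin ψ.numEqs)
    (Y := Sum.elim φ.Y ψ.Y) (Z := Sum.elim φ.Z ψ.Z)
    (fun j i => match j with
      | .inl j => φ.r j i
      | .inr j => ψ.r j i)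
    (fun j k => match j, k with
      | .inl j, .inl k => φ.s j k
      | .inl _, .inr _ => 0
      | .inr _, .inl _ => 0
      | .inr j, .inr k => ψ.s j k)

theorem PPFormula.mem_sol_and {φ ψ : PPFormula X} {M : RMod C} {a : Tuple M X} :
    a ∈ (φ.and ψ).sol M ↔ a ∈ φ.sol M ∧ a ∈ ψ.sol M := by
  refine PPFormula.mem_sol_ofFintype.trans ⟨?_, ?_⟩
  · rintro ⟨b, hb⟩
    refine ⟨⟨fun k => b (.inl k), fun j => ?_⟩, ⟨fun k => b (.inr k), fun j => ?_⟩⟩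
    · refine Eq.trans ?_ (hb (.inl j))
      rw [linComb_sum_elim]
      refine congrArg _ ((add_zero _).symm.trans (congrArg _ (linComb_zero _).symm))
    · refine Eq.trans ?_ (hb (.inr j))
      rw [linComb_sum_elim]
      refine congrArg _ ((zero_add _).symm.trans (congrArg (· + _) (linComb_zero _).symm))
  · rintro ⟨⟨b, hb⟩, ⟨c, hc⟩⟩
    refine ⟨fun k => match k with
      | .inl k => b k
      | .inr k => c k, fun j => ?_⟩
    rcases j with j | j
    · refine Eq.trans ?_ (hb j)
      rw [linComb_sum_elim]
      exact congrArg _ ((congrArg _ (linComb_zero _)).trans (add_zero _))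
    · refine Eq.trans ?_ (hc j)
      rw [linComb_sum_elim]
      exact congrArg _ ((congrArg (· + _) (linComb_zero _)).trans (zero_add _))

variable {m : ℕ} {Y : Fin m → C}

/-- The pp formula `φ(x r)`. -/
def PPFormula.subst (φ : PPFormula Y) (r : ∀ i j, Y i ⟶ X j) : PPFormula X where
  numBound := φ.numBound
  Y := φ.Y
  numEqs := φ.numEqs
  Z := φ.Z
  r j i := ∑ k, φ.r j k ≫ r k i
  s := φ.s

theorem PPFormula.mem_sol_subst {φ : PPFormula Y} {r : ∀ i j, Y i ⟶ X j} {M : RMod C}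
    {a : Tuple M X} : a ∈ (φ.subst r).sol M ↔ a.mul r ∈ φ.sol M := by
  have key : ∀ j, lin (a.mul r) (φ.r j) = lin a ((φ.subst r).r j) :=
    fun j => linComb_linComb a r (φ.r j)
  constructor
  · rintro ⟨b, hb⟩
    exact ⟨b, fun j => (congrArg (· + lin b (φ.s j)) (key j)).trans (hb j)⟩
  · rintro ⟨b, hb⟩
    exact ⟨b, fun j => (congrArg (· + lin b (φ.s j)) (key j).symm).trans (hb j)⟩

open Classical in
/-- The pp formula `∃ x, φ(x) ∧ y = x r`. -/
noncomputable def PPFormula.image (φ : PPFormula X) (r : ∀ i j, Y i ⟶ X j) : PPFormula Y :=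
  PPFormula.ofFintype (κ := Fin n ⊕ Fin φ.numBound) (μ := Fin φ.numEqs ⊕ Fin m)
    (Y := Sum.elim X φ.Y) (Z := Sum.elim φ.Z Y)
    (fun j i => match j with
      | .inl _ => 0
      -- The coefficient `-𝟙` makes the equation `x r - y = 0`.
      | .inr j => Pi.single (M := fun i => Y j ⟶ Y i) j (-𝟙 (Y j)) i)
    (fun j k => match j, k with
      | .inl j, .inl k => φ.r j k
      | .inl j, .inr k => φ.s j k
      | .inr j, .inl k => r j k
      | .inr _, .inr _ => 0)

/-- Image formulas will generate the pp-types of arbitrary tuples of the colimit. -/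
theorem PPFormula.mem_sol_image {φ : PPFormula X} {r : ∀ i j, Y i ⟶ X j} {M : RMod C}
    {b : Tuple M Y} : b ∈ (φ.image r).sol M ↔ ∃ a ∈ φ.sol M, a.mul r = b := by
  classical
  have single : ∀ j, lin b (fun i => Pi.single (M := fun i => Y j ⟶ Y i) j (-𝟙 (Y j)) i) = -b j := by
    intro j
    refine (linComb_single b j _).trans ?_
    rw [act_neg_right, act_id]
  refine PPFormula.mem_sol_ofFintype.trans ⟨?_, ?_⟩
  · rintro ⟨c, hc⟩
    refine ⟨fun k => c (.inl k), ⟨fun k => c (.inr k), fun j => ?_⟩, funext fun j => ?_⟩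
    · refine Eq.trans ?_ (hc (.inl j))
      rw [linComb_sum_elim]
      exact (zero_add _).symm.trans (congrArg (· + _) (linComb_zero b).symm)
    · have := hc (.inr j)
      rw [linComb_sum_elim] at this
      replace this := (congrArg₂ (fun x y : Elt M (Y j) => x + y) (single j).symm
        ((add_zero _).symm.trans (congrArg _ (linComb_zero _).symm))).trans this
      exact (neg_add_eq_zero.mp this).symm
  · rintro ⟨a, ⟨c, hc⟩, rfl⟩
    refine ⟨fun k => match k with
      | .inl k => a k
      | .inr k => c k, fun j => ?_⟩
    rw [linComb_sum_elim]
    rcases j with j | j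
    · refine Eq.trans ?_ (hc j)
      exact (congrArg (· + _) (linComb_zero _)).trans (zero_add _)
    · refine (congrArg₂ (fun x y : Elt M (Y j) => x + y) (single j)
        ((congrArg _ (linComb_zero _)).trans (add_zero _))).trans ?_
      exact neg_add_cancel _

end Formulas

/-! ### Modules given by generators and relations -/

section Presentation

variable {ι κ : Type} [Fintype κ] {X : ι → C} {Z : κ → C} (r : ∀ j i, Z j ⟶ X i)

/-- The linear relations, with coefficients of source `W`, generated by the rows of `r`. -/
def relHom (W : C) : (∀ j, W ⟶ Z j) →+ (∀ i, W ⟶ X i) where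
  toFun d i := ∑ j, d j ≫ r j i
  map_zero' := by ext; simp
  map_add' d d' := by ext; simp [Finset.sum_add_distrib]

/-- Precomposition with a scalar, on families of scalars. -/
def precompHom (X : ι → C) {V W : C} (s : V ⟶ W) : (∀ i, W ⟶ X i) →+ (∀ i, V ⟶ X i) where
  toFun c i := s ≫ c i
  map_zero' := by ext; simp
  map_add' c c' := by ext; simp

theorem range_relHom_le {V W : C} (s : V ⟶ W) :
    (relHom r W).range ≤ (relHom r V).range.comap (precompHom X s) := by
  rintro _ ⟨d, rfl⟩
  refine ⟨precompHom Z s d, ?_⟩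
  funext i
  simp [relHom, precompHom, Preadditive.comp_sum]

/-- The module with generators indexed by `ι` and relations the rows of `r`. -/
def presentedModule : RMod C where
  obj :=
    { obj W := AddCommGrpCat.of ((∀ i, unop W ⟶ X i) ⧸ (relHom r (unop W)).range)
      map s := AddCommGrpCat.ofHom (QuotientAddGroup.map _ _ (precompHom X s.unop)
        (range_relHom_le r s.unop))
      map_id W := by
        ext c
        exact congrArg QuotientAddGroup.mk (funext fun i => Category.id_comp _)
      map_comp s t := by
        ext c
        exact congrArg QuotientAddGroup.mk (funext fun i => Category.assoc _ _ _) }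
  property :=
    { map_add := by
        intro V W s t
        ext c
        exact congrArg QuotientAddGroup.mk (funext fun i => Preadditive.add_comp _ _ _ _ _ _) }

open Classical in
/-- The canonical generators of a presented module. -/
noncomputable def presentedGen (i : ι) : Elt (presentedModule r) (X i) :=
  QuotientAddGroup.mk (Pi.single (M := fun k => X i ⟶ X k) i (𝟙 (X i)))

variable [Fintype ι]

theorem linComb_presentedGen {W : C} (c : ∀ i, W ⟶ X i) :
    linComb (presentedGen r) c = QuotientAddGroup.mk (s := (relHom r W).range) c := by
  classical
  have h1 : ∀ i, act (presentedModule r) (presentedGen r i) (c i) =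
      QuotientAddGroup.mk' (relHom r W).range (Pi.single i (c i)) := by
    intro i
    refine congrArg QuotientAddGroup.mk (funext fun k => ?_)
    change c i ≫ Pi.single (M := fun k => X i ⟶ X k) i (𝟙 (X i)) k =
      Pi.single (M := fun k => W ⟶ X k) i (c i) k
    by_cases h : k = i
    · subst h
      simp
    · rw [Pi.single_eq_of_ne h, Pi.single_eq_of_ne h, Limits.comp_zero]
  rw [linComb, Finset.sum_congr rfl fun i _ => h1 i]
  refine (map_sum (QuotientAddGroup.mk' (relHom r W).range) _ _).symm.trans ?_
  exact congrArg _ (Finset.univ_sum_single c)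

theorem exists_linComb_presentedGen {W : C} (m : Elt (presentedModule r) W) :
    ∃ c : ∀ i, W ⟶ X i, linComb (presentedGen r) c = m := by
  obtain ⟨c, rfl⟩ := QuotientAddGroup.mk_surjective m
  exact ⟨c, linComb_presentedGen r c⟩

theorem linComb_presentedGen_eq_zero {W : C} {c : ∀ i, W ⟶ X i} :
    linComb (presentedGen r) c = 0 ↔ ∃ d : ∀ j, W ⟶ Z j, ∀ i, c i = ∑ j, d j ≫ r j i := by
  rw [linComb_presentedGen]
  refine (QuotientAddGroup.eq_zero_iff c).trans ?_
  exact ⟨fun ⟨d, hd⟩ => ⟨d, fun i => (congrFun hd i).symm⟩,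
    fun ⟨d, hd⟩ => ⟨d, (funext hd).symm⟩⟩

end Presentation

/-! ### Finite presentations and free realisations -/

/-- The module `M` is presented by the generating tuple `a` and the relations listed in the
quantifier-free formula `θ`. -/
structure Presents {n : ℕ} {X : Fin n → C} (θ : PPFormula X) (M : RMod C) (a : Tuple M X) :
    Prop where
  isQF : θ.IsQF
  generates : Generates a
  mem_sol : a ∈ θ.sol M
  exists_eq : ∀ (W : C) (c : ∀ i, W ⟶ X i), lin a c = 0 →
    ∃ d : ∀ j, W ⟶ θ.Z j, ∀ i, c i = ∑ j, d j ≫ θ.r j i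

section Presents

variable {n : ℕ} {X : Fin n → C} {θ : PPFormula X} {M : RMod C} {a : Tuple M X}

theorem Presents.isFP (h : Presents θ M a) : IsFP M :=
  ⟨n, X, a, h.generates, θ.numEqs, θ.Z, θ.r, h.isQF.mem_sol.mp h.mem_sol, h.exists_eq⟩

/-- Every relation on `a` is a combination of the equations of `θ`, so a solution of `θ` satisfies
them all. -/
theorem Presents.exists_hom (h : Presents θ M a) {N : RMod C} {c : Tuple N X} (hc : c ∈ θ.sol N) :
    ∃ f : M ⟶ N, a.map f = c := by
  refine h.generates.exists_hom c fun W r hr => ?_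
  obtain ⟨d, hd⟩ := h.exists_eq W r hr
  obtain rfl : r = fun i => ∑ j, d j ≫ θ.r j i := funext hd
  refine (linComb_linComb c θ.r d).symm.trans ?_
  have : (fun j => linComb c (θ.r j)) = fun j => 0 := funext (h.isQF.mem_sol.mp hc)
  rw [this, linComb_zero_left]

theorem ppType_eq_gen_top {φ : PPFormula X} (ha : a ∈ φ.sol M)
    (h : ∀ N : RMod C, ∀ c ∈ φ.sol N, ∃ f : M ⟶ N, a.map f = c) : ppType a = gen ⊤ φ := by
  ext ψ
  refine ⟨fun hψ N _ c hc => ?_, fun hψ => hψ M trivial ha⟩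
  obtain ⟨f, rfl⟩ := h N c hc
  exact ψ.sol_map f hψ

theorem Presents.ppType_eq (h : Presents θ M a) : ppType a = gen ⊤ θ :=
  ppType_eq_gen_top h.mem_sol fun _ _ hc => h.exists_hom hc

/-- Every finite generating tuple of a finitely presented module gives a finite presentation. -/
theorem IsFP.exists_presents (hM : IsFP M) (ha : Generates a) : ∃ θ : PPFormula X,
    Presents θ M a := by
  classical
  obtain ⟨n', X', a', ha', m, Z, r, hr, hrel⟩ := hM
  obtain ⟨s, rfl⟩ := ha.exists_mul a'
  obtain ⟨t, ht⟩ := ha'.exists_mul a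
  let e := (finSumFinEquiv (m := m) (n := n)).symm
  let Z' : Fin m ⊕ Fin n → C := Sum.elim Z X
  -- Two kinds of relations: the old ones rewritten through `s`, and those expressing `a = a s t`.
  let r' : ∀ j i, Z' j ⟶ X i := fun j i => match j with
    | .inl j => ∑ k, r j k ≫ s k i
    | .inr j => Pi.single (M := fun i => X j ⟶ X i) j (𝟙 (X j)) i - ∑ k, t j k ≫ s k i
  let θ : PPFormula X :=
    { numBound := 0
      Y := Fin.elim0
      numEqs := m + n
      Z := fun j => Z' (e j)
      r := fun j i => r' (e j) i
      s := fun _ k => k.elim0 }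
  have hθ : θ.IsQF := rfl
  have hts : ∀ {W : C} (c : ∀ i, W ⟶ X i), lin (a.mul s) (fun k => ∑ i, c i ≫ t i k) = lin a c := by
    intro W c
    refine (linComb_linComb (a.mul s) t c).symm.trans ?_
    exact congrArg (fun x => linComb x c) ht
  refine ⟨θ, hθ, ha, hθ.mem_sol.mpr ?_, ?_⟩
  · suffices ∀ j, lin a (r' j) = 0 from fun j => this (e j)
    rintro (j | j)
    · exact (linComb_linComb a s (r j)).symm.trans (hr j)
    · refine (linComb_sub a _ _).trans (sub_eq_zero.mpr ?_)
      refine (linComb_single a j _).trans ((act_id M _).trans ?_)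
      exact (congrFun ht j).symm.trans (linComb_linComb a s (t j))
  · intro W c hc
    -- Split `c = c t s + (c - c t s)`. Here `c t` is a relation on the old generators, which
    -- handles the first summand; the second is a combination of the relations `a = a s t`.
    obtain ⟨d, hd⟩ := hrel W (fun k => ∑ i, c i ≫ t i k) ((hts c).trans hc)
    let d' : ∀ j, W ⟶ Z' j := fun j => match j with
      | .inl j => d j
      | .inr j => c j
    refine ⟨fun j => d' (e j), fun i => Eq.trans ?_
      (e.sum_comp (fun j => d' j ≫ r' j i)).symm⟩
    have h1 : ∑ j, d j ≫ (∑ k, r j k ≫ s k i) = ∑ k, (∑ i, c i ≫ t i k) ≫ s k i := by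
      simp only [hd, Preadditive.comp_sum, Preadditive.sum_comp, Category.assoc]
      exact Finset.sum_comm
    have h2 : ∑ j, c j ≫ (Pi.single (M := fun i => X j ⟶ X i) j (𝟙 (X j)) i - ∑ k, t j k ≫ s k i) =
        c i - ∑ k, (∑ i, c i ≫ t i k) ≫ s k i := by
      simp only [Preadditive.comp_sub, Finset.sum_sub_distrib]
      congr 1
      · rw [Finset.sum_eq_single i]
        · simp
        · intro j _ hj
          rw [Pi.single_eq_of_ne (Ne.symm hj), Limits.comp_zero]
        · simp
      · simp only [Preadditive.comp_sum, Preadditive.sum_comp, Category.assoc]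
        exact Finset.sum_comm
    refine Eq.trans ?_ (Fintype.sum_sum_type _).symm
    refine Eq.trans ?_ (congrArg₂ (· + ·) h1.symm h2.symm)
    simp

end Presents

/-- Every pp formula has a free realisation. -/
theorem exists_freeRealisation {n : ℕ} {X : Fin n → C} (φ : PPFormula X) :
    ∃ (M : RMod C) (a : Tuple M X), IsFreeRealisation φ M a ∧
      ∀ N : RMod C, ∀ c ∈ φ.sol N, ∃ f : M ⟶ N, a.map f = c := by
  -- The quantified variables become additional generators and the equations of `φ` become the
  -- relations.
  let X' : Fin n ⊕ Fin φ.numBound → C := Sum.elim X φ.Y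
  let r : ∀ j i, φ.Z j ⟶ X' i := fun j i => match i with
    | .inl i => φ.r j i
    | .inr k => φ.s j k
  let e := (finSumFinEquiv (m := n) (n := φ.numBound)).symm
  let M := presentedModule r
  let g : ∀ i, Elt M (X' i) := presentedGen r
  let b : Tuple M (fun i => X' (e i)) := fun i => g (e i)
  let θ : PPFormula (fun i => X' (e i)) :=
    { numBound := 0
      Y := Fin.elim0
      numEqs := φ.numEqs
      Z := φ.Z
      r := fun j i => r j (e i)
      s := fun _ k => k.elim0 }
  have hθ : θ.IsQF := rfl
  have hg : ∀ j, linComb g (r j) = 0 := by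
    classical
    intro j
    refine (linComb_presentedGen_eq_zero r).mpr ⟨Pi.single j (𝟙 _), fun i => ?_⟩
    rw [Finset.sum_eq_single j]
    · simp
    · intro k _ hk
      rw [Pi.single_eq_of_ne hk, Limits.zero_comp]
    · simp
  have hP : Presents θ M b := by
    refine ⟨hθ, fun W m => ?_, hθ.mem_sol.mpr fun j => ?_, fun W c hc => ?_⟩
    · obtain ⟨c, hc⟩ := exists_linComb_presentedGen r m
      exact ⟨fun i => c (e i), (linComb_equiv e g c).trans hc⟩
    · exact (linComb_equiv e g (r j)).trans (hg j)
    · obtain ⟨c, rfl⟩ := exists_comp_equiv_eq (β := fun i => W ⟶ X' i) e c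
      obtain ⟨d, hd⟩ := (linComb_presentedGen_eq_zero r).mp ((linComb_equiv e g c).symm.trans hc)
      exact ⟨d, fun i => hd (e i)⟩
  let a : Tuple M X := fun i => g (.inl i)
  have ha : a ∈ φ.sol M :=
    ⟨fun k => g (.inr k), fun j => (linComb_sum_elim g (r j)).symm.trans (hg j)⟩
  have huniv : ∀ N : RMod C, ∀ c ∈ φ.sol N, ∃ f : M ⟶ N, a.map f = c := by
    rintro N c ⟨c', hc⟩
    let c'' : ∀ i, Elt N (X' i) := fun i => match i with
      | .inl i => c i
      | .inr k => c' k
    obtain ⟨f, hf⟩ := hP.exists_hom (c := fun i => c'' (e i)) <| hθ.mem_sol.mpr fun j =>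
      (linComb_equiv e c'' (r j)).trans ((linComb_sum_elim c'' (r j)).trans (hc j))
    have hf' : ∀ i, mapElt f _ (g i) = c'' i := fun i => by
      obtain ⟨i, rfl⟩ := e.surjective i
      exact congrFun hf i
    exact ⟨f, funext fun i => hf' (.inl i)⟩
  exact ⟨M, a, ⟨hP.isFP, ppType_eq_gen_top ha huniv⟩, huniv⟩

/-! ### Directed colimits of sequences of modules -/

theorem preservesColimitsOfShape_nat_forget :
    Limits.PreservesColimitsOfShape ℕ (forget AddCommGrpCat.{v}) := by
  have := Limits.preservesFilteredColimitsOfSize_shrink.{0, v, 0, v} (forget AddCommGrpCat.{v})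
  infer_instance

/-- A sequence of modules has a colimit, all of whose elements come from terms of the sequence. -/
theorem exists_isColimit (B : ℕ ⥤ RMod C) :
    ∃ (L : RMod C) (ι : B ⟶ (Functor.const ℕ).obj L),
      Nonempty (Limits.IsColimit (Limits.Cocone.mk L ι)) ∧
      ∀ (X : C) (m : Elt L X), ∃ (k : ℕ) (m' : Elt (B.obj k) X), mapElt (ι.app k) X m' = m := by
  have := preservesColimitsOfShape_nat_forget.{v}
  let F : ℕ ⥤ Cᵒᵖ ⥤ AddCommGrpCat.{v} := B ⋙ AdditiveFunctor.forget _ _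
  let c := Limits.colimit.cocone F
  have hc : Limits.IsColimit c := Limits.colimit.isColimit F
  have hcX : ∀ X : Cᵒᵖ, Limits.IsColimit (((evaluation _ _).obj X).mapCocone c) := fun X =>
    Limits.isColimitOfPreserves ((evaluation _ _).obj X) hc
  have hrep : ∀ (X : Cᵒᵖ) (m : c.pt.obj X), ∃ (k : ℕ) (m' : (F.obj k).obj X),
      ((c.ι.app k).app X).hom m' = m := fun X m =>
    Limits.Concrete.isColimit_exists_rep (F ⋙ (evaluation _ _).obj X) (hcX X) m
  -- The colimit is formed among all functors; additivity is checked on representatives in a term of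
  -- the sequence.
  have hadd : c.pt.Additive :=
    { map_add := by
        intro X Y r s
        ext m
        obtain ⟨k, m, rfl⟩ := hrep X m
        have hnat : ∀ t : X ⟶ Y, (c.pt.map t).hom (((c.ι.app k).app X).hom m) =
            ((c.ι.app k).app Y).hom (((B.obj k).obj.map t).hom m) := fun t =>
          (ConcreteCategory.congr_hom ((c.ι.app k).naturality t) m).symm
        have h2 : ((B.obj k).obj.map (r + s)).hom m =
            ((B.obj k).obj.map r).hom m + ((B.obj k).obj.map s).hom m := by
          rw [(B.obj k).obj.map_add]
          rfl
        refine (hnat (r + s)).trans ?_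
        rw [h2, map_add, ← hnat, ← hnat]
        rfl }
  let L : RMod C := ⟨c.pt, hadd⟩
  let ι : B ⟶ (Functor.const ℕ).obj L :=
    { app := fun k => ObjectProperty.homMk (c.ι.app k)
      naturality := fun k l h => ObjectProperty.hom_ext _ (c.ι.naturality h) }
  exact ⟨L, ι, ⟨Limits.isColimitOfReflects (AdditiveFunctor.forget _ _) hc⟩,
    fun X m => hrep (op X) m⟩

end

/-- If morphisms to `N` extend along each step of a sequence, then they extend to its colimit. -/
theorem exists_extension_of_isColimit {𝒞 : Type*} [Category* 𝒞] {B : ℕ ⥤ 𝒞} {c : Limits.Cocone B}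
    (hc : Limits.IsColimit c) {N : 𝒞}
    (h : ∀ (j : ℕ) (g : B.obj j ⟶ N), ∃ g' : B.obj (j + 1) ⟶ N,
      B.map (homOfLE (Nat.le_succ j)) ≫ g' = g)
    (k : ℕ) (g : B.obj k ⟶ N) : ∃ g' : c.pt ⟶ N, c.ι.app k ≫ g' = g := by
  choose ext hext using h
  let G : ∀ d : ℕ, B.obj (k + d) ⟶ N := fun d => Nat.rec g (fun d g => ext (k + d) g) d
  have hG : ∀ d, B.map (homOfLE (Nat.le_succ (k + d))) ≫ G (d + 1) = G d := fun d => hext _ _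
  have hk : ∀ d, B.map (homOfLE (Nat.le_add_right k d)) ≫ G d = g := by
    intro d
    induction d with
    | zero => exact (congrArg (· ≫ G 0) (B.map_id k)).trans (Category.id_comp _)
    | succ d ih =>
      rw [← ih, ← hG d, ← Category.assoc, ← B.map_comp]
      rfl
  -- Passing from `B j` to `B (k + j)` first defines the cocone at every index, including those
  -- below `k`.
  let α : B ⟶ (Functor.const ℕ).obj N := NatTrans.ofSequence
    (fun j => B.map (homOfLE (Nat.le_add_left j k)) ≫ G j) fun j => by
      change _ = _ ≫ 𝟙 N
      rw [Category.comp_id, ← hG j, ← Category.assoc, ← Category.assoc, ← B.map_comp,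
        ← B.map_comp]
      rfl
  exact ⟨hc.desc ⟨N, α⟩, (hc.fac ⟨N, α⟩ k).trans (hk k)⟩

/-! ### Stages and the bookkeeping of pending formulas -/

section

variable {C : Type w} [Category.{v} C] [Preadditive C]

theorem mem_ppType {M : RMod C} {n : ℕ} {X : Fin n → C} {a : Tuple M X} {φ : PPFormula X} :
    φ ∈ ppType a ↔ a ∈ φ.sol M := Iff.rfl

/-- A presented module together with a list of pp formulas, all implied on `D` by the presenting
formula, which the image of the generating tuple has to satisfy in the colimit. -/
structure Stage (D : ObjectProperty (RMod C)) where
  /-- the module -/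
  M : RMod C
  {n : ℕ}
  {X : Fin n → C}
  /-- the generating tuple -/
  b : Tuple M X
  /-- the quantifier-free formula presenting the module -/
  θ : PPFormula X
  presents : Presents θ M b
  /-- the formulas still to be realised -/
  pending : ℕ → PPFormula X
  pending_mem : ∀ t, pending t ∈ gen D θ

/-- The pending formulas with indices `Nat.pair k j` are all the formulas implied on `D` by `θ`. -/
def Stage.ListsAt {D : ObjectProperty (RMod C)} (s : Stage D) (k : ℕ) : Prop :=
  ∀ ψ ∈ gen D s.θ, ∃ t, (Nat.unpair t).1 = k ∧ s.pending t = ψ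

/-- The stage `s'` is obtained from `s` by realising the pending formula number `k`. -/
structure Stage.Step {D : ObjectProperty (RMod C)} (k : ℕ) (s s' : Stage D) (f : s.M ⟶ s'.M) :
    Prop where
  exists_free : ∃ σ ∈ down D s.θ, IsFreeRealisation σ s'.M (s.b.map f)
  exists_extension : ∀ N : RMod C, D N → ∀ g : s.M ⟶ N, ∃ g' : s'.M ⟶ N, f ≫ g' = g
  realises : s.b.map f ∈ (s.pending k).sol s'.M
  -- Slots with first coordinate `k + 1` are reserved for the formulas of the new stage; all others
  -- are carried over.
  pending_of_pending : ∀ t, (Nat.unpair t).1 ≠ k + 1 → ∀ (N : RMod C) (g : s'.M ⟶ N),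
    s'.b.map g ∈ (s'.pending t).sol N → s.b.map (f ≫ g) ∈ (s.pending t).sol N
  listsAt : s'.ListsAt (k + 1)

/-- In the colimit every formula implied on `D` by a presenting formula gets realised. -/
theorem Stage.mem_sol_colimit {D : ObjectProperty (RMod C)} {S : ℕ → Stage D} {f : ∀ k, (S k).M ⟶ (S (k + 1)).M}
    (h0 : (S 0).ListsAt 0) (hS : ∀ k, Stage.Step k (S k) (S (k + 1)) (f k)) {L : RMod C}
    {ι : ∀ k, (S k).M ⟶ L} (hι : ∀ k, f k ≫ ι (k + 1) = ι k) (k : ℕ) {ψ : PPFormula (S k).X}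
    (hψ : ψ ∈ gen D (S k).θ) : (S k).b.map (ι k) ∈ ψ.sol L := by
  -- Induction on the number `d` of steps before slot `t` has its turn. First coordinate at most `k`
  -- means that no later step overwrites the slot.
  have key : ∀ d k t, k + d = t → (Nat.unpair t).1 ≤ k →
      (S k).b.map (ι k) ∈ ((S k).pending t).sol L := by
    intro d
    induction d with
    | zero =>
      rintro k _ rfl -
      rw [← hι, Tuple.map_comp]
      exact ((S k).pending (k + 0)).sol_map _ (hS k).realises
    | succ d ih =>
      intro k t ht hk
      rw [← hι]
      exact (hS k).pending_of_pending t (by lia) L _ (ih (k + 1) t (by lia) (by lia))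
  have hk : (S k).ListsAt k := by
    cases k with
    | zero => exact h0
    | succ k => exact (hS k).listsAt
  obtain ⟨t, rfl, rfl⟩ := hk ψ hψ
  -- A code is at least its first coordinate, so the turn of slot `t` has not passed at stage `k`.
  exact key _ _ t (Nat.add_sub_cancel' (Nat.unpair_left_le t)) le_rfl

theorem exists_tuple_rep {B : ℕ ⥤ RMod C} {L : RMod C} {ι : B ⟶ (Functor.const ℕ).obj L}
    (h : ∀ (X : C) (m : Elt L X), ∃ (k : ℕ) (m' : Elt (B.obj k) X), mapElt (ι.app k) X m' = m)
    {n : ℕ} {X : Fin n → C} (a : Tuple L X) :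
    ∃ (k : ℕ) (a' : Tuple (B.obj k) X), a'.map (ι.app k) = a := by
  choose k a' ha' using fun i => h (X i) (a i)
  refine ⟨Finset.univ.sup k,
    fun i => mapElt (B.map (homOfLE (Finset.le_sup (Finset.mem_univ i)))) _ (a' i),
    funext fun i => ?_⟩
  rw [Tuple.map_apply, ← mapElt_comp, ι.naturality]
  exact ha' i

variable [Countable C] [∀ X Y : C, Countable (X ⟶ Y)] (D : ObjectProperty (RMod C))

theorem exists_enumeration {n : ℕ} {X : Fin n → C} (θ : PPFormula X) :
    ∃ F : ℕ → gen D θ, Function.Surjective F := by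
  have : Nonempty (gen D θ) := ⟨θ, fun _ _ => subset_rfl⟩
  exact exists_surjective_nat _

theorem exists_stage {A : RMod C} (hA : IsFP A) : ∃ s : Stage D, s.M = A ∧ s.ListsAt 0 := by
  obtain ⟨n, X, b, hb, -⟩ := id hA
  obtain ⟨θ, hθ⟩ := hA.exists_presents hb
  obtain ⟨F, hF⟩ := exists_enumeration D θ
  -- Only slots with first coordinate `0` matter; the others are overwritten before their turn.
  refine ⟨⟨A, b, θ, hθ, fun t => F (Nat.unpair t).2, fun t => (F _).2⟩, rfl, fun ψ hψ => ?_⟩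
  obtain ⟨j, hj⟩ := hF ⟨ψ, hψ⟩
  exact ⟨Nat.pair 0 j, by simp, by simp [hj]⟩

variable {D}

/-- The next module freely realises `θ ∧ pending k`, which is equivalent to `θ` on `D`. The old
tuple need not generate it, so new generators are chosen and the pending formulas are rewritten in
terms of them. -/
theorem Stage.exists_step (k : ℕ) (s : Stage D) :
    ∃ (s' : Stage D) (f : s.M ⟶ s'.M), Stage.Step k s s' f := by
  obtain ⟨M', a, hfree, huniv⟩ := exists_freeRealisation (s.θ.and (s.pending k))
  have ha : a ∈ (s.θ.and (s.pending k)).sol M' := by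
    rw [← mem_ppType, hfree.2]
    exact fun _ _ => subset_rfl
  obtain ⟨ha1, ha2⟩ := PPFormula.mem_sol_and.mp ha
  obtain ⟨f, rfl⟩ := s.presents.exists_hom ha1
  obtain ⟨n', X', b', hb', -⟩ := id hfree.1
  obtain ⟨θ', hθ'⟩ := hfree.1.exists_presents hb'
  obtain ⟨r, hr⟩ := hb'.exists_mul (s.b.map f)
  obtain ⟨F, hF⟩ := exists_enumeration D θ'
  have hθ : ∀ {N : RMod C} (g : s.M ⟶ N), s.b.map g ∈ s.θ.sol N := fun g =>
    s.θ.sol_map g s.presents.mem_sol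
  let s' : Stage D :=
    { M := M'
      b := b'
      θ := θ'
      presents := hθ'
      pending := fun t =>
        if (Nat.unpair t).1 = k + 1 then F (Nat.unpair t).2 else (s.pending t).subst r
      pending_mem := fun t => by
        split_ifs
        · exact (F _).2
        -- A solution of `θ'` in `N` is a map from `M'`; composing with `f` gives a solution of `θ`,
        -- hence of the pending formula.
        · intro N hN c hc
          obtain ⟨g, rfl⟩ := hθ'.exists_hom hc
          rw [PPFormula.mem_sol_subst, ← Tuple.map_mul, hr, ← Tuple.map_comp]
          exact s.pending_mem t N hN (hθ _) }
  refine ⟨s', f, ⟨⟨_, ⟨fun N _ c hc => (PPFormula.mem_sol_and.mp hc).1, fun N hN => ?_⟩, hfree⟩,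
    fun N hN g => ?_, ha2, fun t ht N g hg => ?_, fun ψ hψ => ?_⟩⟩
  · ext c
    rw [PPFormula.mem_sol_and]
    exact ⟨fun hc => ⟨hc, s.pending_mem k N hN hc⟩, And.left⟩
  · obtain ⟨g', hg'⟩ := huniv N (s.b.map g)
      (PPFormula.mem_sol_and.mpr ⟨hθ g, s.pending_mem k N hN (hθ g)⟩)
    refine ⟨g', hom_ext_elt fun W m => ?_⟩
    obtain ⟨c, rfl⟩ := s.presents.generates W m
    rw [mapElt_lin, mapElt_lin, Tuple.map_comp, hg']
  · have hp : s'.pending t = (s.pending t).subst r := if_neg ht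
    rw [hp] at hg
    rw [Tuple.map_comp, ← hr, Tuple.map_mul]
    exact PPFormula.mem_sol_subst.mp hg
  · obtain ⟨j, hj⟩ := hF ⟨ψ, hψ⟩
    refine ⟨Nat.pair (k + 1) j, by simp, ?_⟩
    simp [s', hj]

theorem exists_stage_sequence (s : Stage D) :
    ∃ (S : ℕ → Stage D) (f : ∀ k, (S k).M ⟶ (S (k + 1)).M), S 0 = s ∧
      ∀ k, Stage.Step k (S k) (S (k + 1)) (f k) := by
  choose next f hf using Stage.exists_step (D := D)
  exact ⟨fun k => Nat.rec s next k, fun k => f k _, rfl, fun k => hf k _⟩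

/-! ### The colimit of the chain -/

/-- A preenvelope of a finitely presented module whose target is strictly atomic, as the colimit
of a chain of free realisations. -/
theorem Stage.exists_preenvelope (hD : IsDefinable D) (s : Stage D) (hs : s.ListsAt 0) :
    ∃ (L : RMod C) (B : ℕ ⥤ RMod C) (ι : B ⟶ (Functor.const ℕ).obj L) (e : s.M ≅ B.obj 0),
      IsPreenvelope D (e.hom ≫ ι.app 0) ∧ IsStrictlyAtomic D L ∧
      (∀ (n : ℕ) (X : Fin n → C) (a : Tuple s.M X), Generates a →
        ∃ θ : PPFormula X, θ.IsQF ∧ ppType a = gen ⊤ θ ∧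
          ppType (a.map (e.hom ≫ ι.app 0)) = gen D θ) ∧
      IsFreeRealisationChain D B ∧ Nonempty (Limits.IsColimit (Limits.Cocone.mk L ι)) := by
  obtain ⟨S, f, rfl, hS⟩ := exists_stage_sequence s
  let B : ℕ ⥤ RMod C := Functor.ofSequence f
  have hB : ∀ k, B.map (homOfLE (Nat.le_succ k)) = f k := Functor.ofSequence_map_homOfLE_succ f
  obtain ⟨L, ι, ⟨hL⟩, hrep⟩ := exists_isColimit B
  have hι : ∀ k, f k ≫ ι.app (k + 1) = ι.app k := fun k => by
    rw [← hB]
    exact (ι.naturality _).trans (Category.comp_id _)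
  have hext : ∀ {N : RMod C}, D N → ∀ (k : ℕ) (g : (S k).M ⟶ N), ∃ h : L ⟶ N, ι.app k ≫ h = g :=
    fun hN => exists_extension_of_isColimit hL fun j g => by
      rw [hB]
      exact (hS j).exists_extension _ hN g
  have hsol : ∀ {k : ℕ} {N : RMod C}, D N → ∀ c ∈ (S k).θ.sol N,
      ∃ h : L ⟶ N, ((S k).b.map (ι.app k)).map h = c := by
    intro k N hN c hc
    obtain ⟨g, rfl⟩ := (S k).presents.exists_hom hc
    obtain ⟨h, rfl⟩ := hext hN k g
    exact ⟨h, rfl⟩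
  have hmem : ∀ {k : ℕ} {ψ : PPFormula (S k).X}, LEOn D (S k).θ ψ →
      (S k).b.map (ι.app k) ∈ ψ.sol L := fun {k} _ hψ =>
    Stage.mem_sol_colimit (ι := fun k => ι.app k) hs hS hι k hψ
  have hmul : ∀ {n : ℕ} {X : Fin n → C} (a : Tuple L X),
      ∃ (k : ℕ) (r : ∀ i j, X i ⟶ (S k).X j), ((S k).b.map (ι.app k)).mul r = a := by
    intro n X a
    obtain ⟨k, a', rfl⟩ := exists_tuple_rep hrep a
    obtain ⟨r, rfl⟩ := (S k).presents.generates.exists_mul a'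
    exact ⟨k, r, (Tuple.map_mul _ _ _).symm⟩
  -- This determines all pp-types in `L` without using that `L` lies in `D`.
  have hpp : ∀ {k n : ℕ} {X : Fin n → C} (r : ∀ i j, X i ⟶ (S k).X j) (ψ : PPFormula X),
      ((S k).b.map (ι.app k)).mul r ∈ ψ.sol L ↔ LEOn D (S k).θ (ψ.subst r) := by
    intro k n X r ψ
    refine ⟨fun h N hN c hc => ?_, fun h => PPFormula.mem_sol_subst.mp (hmem h)⟩
    obtain ⟨g, rfl⟩ := hsol hN c hc
    rw [PPFormula.mem_sol_subst, ← Tuple.map_mul]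
    exact ψ.sol_map g h
  -- By `hpp`, a solution of `p.φ` in `L` amounts to an implication on `D`, where `p.φ` may be
  -- replaced by `p.ψ`.
  have hDL : D L := by
    obtain ⟨Φ, hΦ⟩ := hD
    refine (hΦ L).mpr fun p hp => Set.Subset.antisymm (fun a ha => ?_) (p.le L trivial)
    obtain ⟨k, r, rfl⟩ := hmul a
    rw [hpp] at ha ⊢
    intro N hN c hc
    have := ha N hN hc
    rw [PPFormula.mem_sol_subst] at this ⊢
    exact ((hΦ N).mp hN p hp).subset this
  have himage : ∀ {k n : ℕ} {X : Fin n → C} (r : ∀ i j, X i ⟶ (S k).X j),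
      ppType (((S k).b.map (ι.app k)).mul r) = gen D ((S k).θ.image r) := by
    intro k n X r
    ext ψ
    refine (hpp r ψ).trans ?_
    constructor
    · intro h N hN _ hd
      obtain ⟨c, hc, rfl⟩ := PPFormula.mem_sol_image.mp hd
      exact PPFormula.mem_sol_subst.mp (h N hN hc)
    · intro h N hN c hc
      exact PPFormula.mem_sol_subst.mpr (h N hN (PPFormula.mem_sol_image.mpr ⟨c, hc, rfl⟩))
  refine ⟨L, B, ι, Iso.refl _, ⟨hDL, fun N g hN => ?_⟩, ⟨⟨hDL, fun n X a => ?_⟩, ?_⟩, ?_, ?_, ⟨hL⟩⟩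
  · obtain ⟨h, hh⟩ := hext hN 0 g
    exact ⟨h, hh⟩
  · obtain ⟨k, r, rfl⟩ := hmul a
    exact ⟨_, himage r⟩
  · intro n X a φ hφ N hN c hc
    obtain ⟨k, r, rfl⟩ := hmul a
    -- `φ` and the image formula generate the same type modulo `D`, so `c = d r` for a solution `d`
    -- of the presenting formula, and `d` is the image of the stage tuple under a map from `L`.
    have hc' : c ∈ ((S k).θ.image r).sol N := by
      have : (S k).θ.image r ∈ gen D φ := by
        rw [← hφ, himage]
        exact fun _ _ => subset_rfl
      exact this N hN hc
    obtain ⟨d, hd, rfl⟩ := PPFormula.mem_sol_image.mp hc'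
    obtain ⟨h, rfl⟩ := hsol hN d hd
    exact ⟨h, Tuple.map_mul _ _ _⟩
  · intro n X a ha
    obtain ⟨θ, hθ⟩ := (S 0).presents.isFP.exists_presents ha
    refine ⟨θ, hθ.isQF, hθ.ppType_eq, ?_⟩
    ext ψ
    change a.map (ι.app 0) ∈ ψ.sol L ↔ _
    constructor
    · intro h N hN c hc
      obtain ⟨g, rfl⟩ := hθ.exists_hom hc
      obtain ⟨g', rfl⟩ := hext hN 0 g
      exact ψ.sol_map g' h
    · intro h
      -- Writing `a = b r` reduces the claim to `hpp` at stage `0`: a solution of the stage formula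
      -- is a map from the initial module, which carries `a` to a solution of `θ`.
      obtain ⟨r, rfl⟩ := (S 0).presents.generates.exists_mul a
      refine (congrArg (· ∈ ψ.sol L) (Tuple.map_mul (ι.app 0) _ r)).mpr ((hpp r ψ).mpr ?_)
      intro N hN c hc
      obtain ⟨g, rfl⟩ := (S 0).presents.exists_hom hc
      rw [PPFormula.mem_sol_subst, ← Tuple.map_mul]
      exact h N hN (θ.sol_map g hθ.mem_sol)
  · intro k
    obtain ⟨σ, hσ, hfree⟩ := (hS k).exists_free
    refine ⟨_, _, (S k).b, (S k).θ, σ, (S k).presents.generates, (S k).presents.isQF,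
      ⟨(S k).presents.isFP, (S k).presents.ppType_eq⟩, hσ, ?_⟩
    rw [hB]
    exact hfree

end

end PPModules

theorem theorem4p11 {C : Type w} [Category.{v} C] [Preadditive C]
    [Countable C] [∀ X Y : C, Countable (X ⟶ Y)]
    (D : ObjectProperty (PPModules.RMod C)) (hD : PPModules.IsDefinable D)
    (A : PPModules.RMod C) (hA : PPModules.IsFP A) :
    ∃ (DA : PPModules.RMod C) (f : A ⟶ DA),
      PPModules.IsPreenvelope D f ∧
      PPModules.IsStrictlyAtomic D DA ∧
      (∀ (n : ℕ) (X : Fin n → C) (a : PPModules.Tuple A X), PPModules.Generates a →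
        ∃ θ : PPModules.PPFormula X, θ.IsQF ∧ PPModules.ppType a = PPModules.gen ⊤ θ ∧
          PPModules.ppType (a.map f) = PPModules.gen D θ) ∧
      ∃ (B : ℕ ⥤ PPModules.RMod C) (ι : B ⟶ (Functor.const ℕ).obj DA) (e : A ≅ B.obj 0),
        PPModules.IsFreeRealisationChain D B ∧
        Nonempty (Limits.IsColimit (Limits.Cocone.mk DA ι)) ∧
        f = e.hom ≫ ι.app 0 := by
  obtain ⟨s, rfl, hs⟩ := PPModules.exists_stage D hA
  obtain ⟨L, B, ι, e, henv, hatomic, hgen, hchain, hL⟩ := s.exists_preenvelope hD hs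
  exact ⟨L, e.hom ≫ ι.app 0, henv, hatomic, hgen, B, ι, e, hchain, hL, rfl⟩
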